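/- Let $G$ be a compact connected semisimple Lie group with normalized Haar measure $\mu$, let $\mathfrak t$ be a Cartan subalgebra of its Lie algebra $\mathfrak g$, and fix a system of positive roots of $\mathfrak g_{\mathbb C}$ with respect to $\mathfrak t_{\mathbb C}$. Let $\pi$ be an irreducible unitary representation of $G$ on a finite-dimensional complex Hilbert space $D_\lambda$ with normalized lowest weight vector $|{-\lambda}\rangle$, i.e. a unit vector that is a weight vector of weight $-\lambda$ for $\mathfrak t$ and is annihilated by the root vectors $E_{-\alpha}$ for all positive roots $\alpha$. The coherent states are $|\zeta_g\rangle=\pi(g)|{-\lambda}\rangle$, $g\in G$. For a density operator $\rho$ on $D_\lambda$ (a positive semidefinite operator of trace one) let $\rho(g)=\langle\zeta_g|\rho|\zeta_g\rangle$ be its Husimi function, and define its Rényi–Wehrl entropy of index $q>0$ by $$S^{(q)}[\rho]=\frac{1}{1-q}\log\Bigl(\dim D_\lambda\int_G \rho(g)^q\,d\mu(g)\Bigr)\quad(q\neq 1),\qquad S^{(1)}[\rho]=-\dim D_\lambda\int_G\rho(g)\log\rho(g)\,d\mu(g),$$ with $0\log 0=0$. If, for some $q>0$, a density operator $\rho$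 minimizes $S^{(q)}$ among all density operators on $D_\lambda$, then $\rho$ is a pure state, i.e. $\rho=|\psi\rangle\langle\psi|$ for some unit vector $\psi\in D_\lambda$. -/

import Mathlib

open MeasureTheory
open scoped Manifold ContDiff InnerProductSpace

/-- Over `ℝ`, the regularity `minSmoothness ℝ 3` is `3`, so that a smooth Lie group has a Lie
algebra in the sense of Mathlib's `GroupLieAlgebra`. -/
instance instLEInftyMinSmoothnessReal : ENat.LEInfty (minSmoothness ℝ 3) where
  out := by
    rw [minSmoothness_of_isRCLikeNormedField]
    exact ENat.LEInfty.out

noncomputable section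

namespace CoherentState

section RootSystem

variable {L : Type*} [LieRing L] [LieAlgebra ℝ L]

/-- Elements of the complexification `L_ℂ = L ⊕ iL` of a real Lie algebra `L` are written `X + iY`
with `X, Y ∈ L`. The element `X + iY` lies in the (possibly trivial) eigenspace for `α : t → ℂ` of
the adjoint action of the subalgebra `t ⊆ L`: `[H, X + iY] = α(H) (X + iY)` for all `H ∈ t`, in real
and imaginary parts. -/
def MemRootSpace (t : LieSubalgebra ℝ L) (α : t →ₗ[ℝ] ℂ) (X Y : L) : Prop :=
  ∀ H : t, ⁅(H : L), X⁆ = (α H).re • X - (α H).im • Y ∧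
    ⁅(H : L), Y⁆ = (α H).im • X + (α H).re • Y

/-- `α` is a root of `L_ℂ` with respect to the Cartan subalgebra `t_ℂ` (given by its restriction
to `t`): it is non-zero and its root space is non-zero. -/
def IsRoot (t : LieSubalgebra ℝ L) (α : t →ₗ[ℝ] ℂ) : Prop :=
  α ≠ 0 ∧ ∃ X Y : L, (X ≠ 0 ∨ Y ≠ 0) ∧ MemRootSpace t α X Y

/-- A system of positive roots: a set of roots that contains exactly one of `α`, `-α` for every
root `α`, and that is closed under those sums which are roots. -/
structure IsPositiveSystem (t : LieSubalgebra ℝ L) (P : Set (t →ₗ[ℝ] ℂ)) : Prop where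
  isRoot : ∀ α ∈ P, IsRoot t α
  xor_neg_mem : ∀ α, IsRoot t α → Xor (α ∈ P) (-α ∈ P)
  add_mem : ∀ α ∈ P, ∀ β ∈ P, IsRoot t (α + β) → α + β ∈ P

end RootSystem

section LieGroup

variable {E : Type*} [NormedAddCommGroup E] [NormedSpace ℝ E] [FiniteDimensional ℝ E]
  {G : Type*} [TopologicalSpace G] [ChartedSpace E G] [Group G] [LieGroup 𝓘(ℝ, E) ∞ G]
  {V : Type*} [NormedAddCommGroup V] [InnerProductSpace ℂ V]

/-- A finite-dimensional representation `π` of `G` on a Hilbert space is a smooth unitary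
irreducible representation. -/
structure IsUnitaryIrrep (π : Representation ℂ G V) : Prop where
  smooth : ∀ x : V, ContMDiff 𝓘(ℝ, E) 𝓘(ℝ, V) ∞ (fun g : G => π g x)
  unitary : ∀ (g : G) (x y : V), ⟪π g x, π g y⟫_ℂ = ⟪x, y⟫_ℂ
  irreducible : π.IsIrreducible

/-- The action `dπ(X) x` of the Lie algebra element `X` on the vector `x`: the derivative at the
identity, in the direction `X`, of the orbit map `g ↦ π(g) x`. -/
def lieAction (π : Representation ℂ G V) (X : GroupLieAlgebra 𝓘(ℝ, E) G) (x : V) : V :=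
  mfderiv 𝓘(ℝ, E) 𝓘(ℝ, V) (fun g : G => π g x) 1 X

/-- `v` is a lowest weight vector of weight `-lam` with respect to the Cartan subalgebra `t` and the
system `P` of positive roots: a non-zero common eigenvector of `t` that is annihilated by all
lowering operators `E_{-α} = X + iY`, `α ∈ P`, of the complexified Lie algebra. -/
structure IsLowestWeightVector (t : LieSubalgebra ℝ (GroupLieAlgebra 𝓘(ℝ, E) G))
    (P : Set (t →ₗ[ℝ] ℂ)) (π : Representation ℂ G V) (lam : t →ₗ[ℝ] ℂ) (v : V) : Prop where
  ne_zero : v ≠ 0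
  weight : ∀ H : t, lieAction π (H : GroupLieAlgebra 𝓘(ℝ, E) G) v = -(lam H) • v
  lowering : ∀ α ∈ P, ∀ X Y : GroupLieAlgebra 𝓘(ℝ, E) G, MemRootSpace t (-α) X Y →
    lieAction π X v + Complex.I • lieAction π Y v = 0

end LieGroup

section Entropy

variable {G : Type*} [Group G] {V : Type*} [NormedAddCommGroup V] [InnerProductSpace ℂ V]

/-- A density operator: a positive semidefinite Hermitian operator of trace one. -/
def IsDensityOperator (ρ : V →ₗ[ℂ] V) : Prop :=
  ρ.IsPositive ∧ LinearMap.trace ℂ V ρ = 1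

/-- A pure state: `ρ = |ψ⟩⟨ψ|` for a unit vector `ψ`. -/
def IsPureState (ρ : V →ₗ[ℂ] V) : Prop :=
  ∃ ψ : V, ‖ψ‖ = 1 ∧ ∀ x : V, ρ x = ⟪ψ, x⟫_ℂ • ψ

/-- The Husimi function `⟨ζ|ρ|ζ⟩`, as a function of the group element `g` that produces the coherent
state `|ζ⟩ = π(g) v`. -/
def husimi (π : Representation ℂ G V) (v : V) (ρ : V →ₗ[ℂ] V) (g : G) : ℝ :=
  (⟪π g v, ρ (π g v)⟫_ℂ).re

variable [MeasurableSpace G]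

/-- The `q`-th moment of the Husimi function, with the normalization constant `dim V`. -/
def moment (μ : Measure G) (π : Representation ℂ G V) (v : V) (q : ℝ) (ρ : V →ₗ[ℂ] V) : ℝ :=
  (Module.finrank ℂ V : ℝ) * ∫ g, husimi π v ρ g ^ q ∂μ

/-- The Wehrl entropy. -/
def wehrlEntropy (μ : Measure G) (π : Representation ℂ G V) (v : V) (ρ : V →ₗ[ℂ] V) : ℝ :=
  -((Module.finrank ℂ V : ℝ) * ∫ g, husimi π v ρ g * Real.log (husimi π v ρ g) ∂μ)

/-- The Rényi–Wehrl entropy of index `q`; for `q = 1` it is the Wehrl entropy. -/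
def renyiWehrlEntropy (μ : Measure G) (π : Representation ℂ G V) (v : V) (q : ℝ)
    (ρ : V →ₗ[ℂ] V) : ℝ :=
  if q = 1 then wehrlEntropy μ π v ρ else 1 / (1 - q) * Real.log (moment μ π v q ρ)

end Entropy

end CoherentState

end

/-! The entropy is strictly quasi-concave: at the midpoint of two states whose Husimi functions
differ somewhere it exceeds the smaller of the two entropies (`renyiWehrlEntropy_lt_midpoint`). So a
minimizer cannot be such a midpoint, and it suffices to split every mixed `ρ` this way
(`exists_eq_midpoint_of_not_isPureState`). Injectivity of the Husimi map is not needed.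
Irreducibility yields a coherent state `z` with `ρ z ≠ 0`; the range of a mixed `ρ` contains a unit
vector `u ⊥ z`, and with `w = ρ z / ‖ρ z‖` the states `ρ ± c (|u⟩⟨u| - |w⟩⟨w|)` already differ at
`z`. -/

/-- The **Cauchy–Schwarz inequality** for the form `⟪T x, y⟫` of a positive operator `T`. -/
theorem LinearMap.IsPositive.norm_inner_sq_le {𝕜 V : Type*} [RCLike 𝕜] [NormedAddCommGroup V]
    [InnerProductSpace 𝕜 V] {T : V →ₗ[𝕜] V} (hT : T.IsPositive) (x y : V) :
    ‖⟪T x, y⟫_𝕜‖ ^ 2 ≤ RCLike.re ⟪T x, x⟫_𝕜 * RCLike.re ⟪T y, y⟫_𝕜 := by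
  let c : PreInnerProductSpace.Core 𝕜 V :=
    { inner := fun x y => ⟪T x, y⟫_𝕜
      conj_inner_symm := fun x y => by rw [inner_conj_symm, hT.isSymmetric]
      re_inner_nonneg := hT.re_inner_nonneg_left
      add_left := fun x y z => by rw [map_add, inner_add_left]
      smul_left := fun x y r => by rw [map_smul, inner_smul_left] }
  have h : ‖⟪T x, y⟫_𝕜‖ * ‖⟪T y, x⟫_𝕜‖ ≤ RCLike.re ⟪T x, x⟫_𝕜 * RCLike.re ⟪T y, y⟫_𝕜 :=
    @InnerProductSpace.Core.inner_mul_inner_self_le 𝕜 V _ _ _ c x y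
  rwa [hT.isSymmetric y x, norm_inner_symm y, ← sq] at h

namespace CoherentState

/-! ### Splitting a mixed state -/

section DensityOperator

variable {V : Type*} [NormedAddCommGroup V] [InnerProductSpace ℂ V]

/-- The rank one operator `|x⟩⟨x|`. -/
noncomputable def ketBra (x : V) : V →ₗ[ℂ] V := (InnerProductSpace.rankOne ℂ x x).toLinearMap

theorem ketBra_apply (x y : V) : ketBra x y = ⟪x, y⟫_ℂ • x := rfl

theorem isSymmetric_ketBra (x : V) : (ketBra x).IsSymmetric := fun y z => by
  simp [ketBra_apply, inner_smul_left, inner_smul_right, mul_comm]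

theorem re_inner_ketBra (x y : V) : (⟪ketBra x y, y⟫_ℂ).re = ‖⟪x, y⟫_ℂ‖ ^ 2 := by
  rw [ketBra_apply, inner_smul_left, Complex.conj_mul']
  norm_cast

theorem isPositive_ketBra (x : V) : (ketBra x).IsPositive :=
  ⟨isSymmetric_ketBra x, fun y => by
    simpa only [RCLike.re_to_complex, re_inner_ketBra] using sq_nonneg _⟩

theorem trace_ketBra [FiniteDimensional ℂ V] {x : V} (hx : ‖x‖ = 1) :
    LinearMap.trace ℂ V (ketBra x) = 1 := by
  rw [ketBra, InnerProductSpace.trace_rankOne, inner_self_eq_norm_sq_to_K, hx]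
  simp

/-- A small enough multiple of the projection onto a vector of the range of a positive operator
can be subtracted from this operator. -/
theorem exists_isPositive_sub_smul_ketBra {T : V →ₗ[ℂ] V} (hT : T.IsPositive) {y : V}
    (hy : y ∈ LinearMap.range T) :
    ∃ s : ℝ, 0 < s ∧ ∀ c : ℝ, 0 ≤ c → c ≤ s → (T - (c : ℂ) • ketBra y).IsPositive := by
  obtain ⟨a, rfl⟩ := hy
  have ha : 0 ≤ (⟪T a, a⟫_ℂ).re := hT.re_inner_nonneg_left a
  -- By Cauchy–Schwarz, `c * ⟪T a, a⟫ ≤ 1` suffices; the `+ 1` covers `⟪T a, a⟫ = 0`.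
  refine ⟨1 / ((⟪T a, a⟫_ℂ).re + 1), by positivity, fun c hc hcs => ⟨?_, fun x => ?_⟩⟩
  · exact hT.isSymmetric.sub ((isSymmetric_ketBra _).smul (Complex.conj_ofReal c))
  · have hx : 0 ≤ (⟪T x, x⟫_ℂ).re := hT.re_inner_nonneg_left x
    have h := hT.norm_inner_sq_le a x
    have hc' : c * (⟪T a, a⟫_ℂ).re ≤ 1 := by
      rw [le_div_iff₀ (by positivity)] at hcs
      linarith
    have key : c * ‖⟪T a, x⟫_ℂ‖ ^ 2 ≤ (⟪T x, x⟫_ℂ).re :=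
      calc c * ‖⟪T a, x⟫_ℂ‖ ^ 2 ≤ c * ((⟪T a, a⟫_ℂ).re * (⟪T x, x⟫_ℂ).re) := by gcongr; exact h
        _ = c * (⟪T a, a⟫_ℂ).re * (⟪T x, x⟫_ℂ).re := by ring
        _ ≤ 1 * (⟪T x, x⟫_ℂ).re := by gcongr
        _ = _ := one_mul _
    rw [LinearMap.sub_apply, LinearMap.smul_apply, inner_sub_left, inner_smul_left,
      Complex.conj_ofReal, map_sub, RCLike.re_to_complex, RCLike.re_to_complex,
      Complex.re_ofReal_mul, re_inner_ketBra]
    linarith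

/-- Cauchy–Schwarz for the pair `z`, `T z` bounds `‖T z‖ ^ 4` by a multiple of `⟪T z, z⟫`. -/
theorem inner_apply_self_ne_zero {T : V →ₗ[ℂ] V} (hT : T.IsPositive) {z : V} (hz : T z ≠ 0) :
    ⟪T z, z⟫_ℂ ≠ 0 := by
  intro h
  have := hT.norm_inner_sq_le z (T z)
  rw [h, map_zero, zero_mul] at this
  have h0 : ‖⟪T z, T z⟫_ℂ‖ = 0 := pow_eq_zero_iff (two_ne_zero) |>.1 (le_antisymm this (sq_nonneg _))
  exact hz (inner_self_eq_zero.1 (norm_eq_zero.1 h0))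

/-- If the range of a density operator contains no non-zero vector orthogonal to `z`, then the state
is pure. -/
theorem isPureState_of_forall_mem_range [FiniteDimensional ℂ V] {ρ : V →ₗ[ℂ] V}
    (hρ : IsDensityOperator ρ) {z : V} (hz : ρ z ≠ 0)
    (h : ∀ y ∈ LinearMap.range ρ, ⟪z, y⟫_ℂ = 0 → y = 0) : IsPureState ρ := by
  have hc : ⟪z, ρ z⟫_ℂ ≠ 0 := by
    rw [← hρ.1.isSymmetric]
    exact inner_apply_self_ne_zero hρ.1 hz
  set c := ⟪z, ρ z⟫_ℂ with hcdef
  -- The difference of the two sides lies in the range and is orthogonal to `z`, so `ρ` has rank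
  -- one.
  have happ : ∀ x, ρ x = (⟪ρ z, x⟫_ℂ / c) • ρ z := fun x => by
    refine sub_eq_zero.1 (h _ ?_ ?_)
    · exact Submodule.sub_mem _ (LinearMap.mem_range_self ρ x)
        (Submodule.smul_mem _ _ (LinearMap.mem_range_self ρ z))
    · rw [inner_sub_right, inner_smul_right, ← hcdef, div_mul_cancel₀ _ hc, hρ.1.isSymmetric,
        sub_self]
  -- Trace one fixes the scale.
  have htr : (‖ρ z‖ : ℂ) ^ 2 = c := by
    have h1 : ρ = c⁻¹ • ketBra (ρ z) := by
      ext x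
      rw [happ x, LinearMap.smul_apply, ketBra_apply, smul_smul, div_eq_inv_mul]
    have h2 := hρ.2
    rw [h1, map_smul, ketBra, InnerProductSpace.trace_rankOne, inner_self_eq_norm_sq_to_K, smul_eq_mul,
      inv_mul_eq_one₀ hc] at h2
    exact h2.symm
  have hn : (‖ρ z‖ : ℂ) ≠ 0 := by simpa using hz
  refine ⟨((‖ρ z‖ : ℂ)⁻¹) • ρ z, ?_, fun x => ?_⟩
  · rw [norm_smul, norm_inv, Complex.norm_real, norm_norm, inv_mul_cancel₀ (norm_ne_zero_iff.2 hz)]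
  · rw [happ x, inner_smul_left, smul_smul, ← htr, map_inv₀, Complex.conj_ofReal]
    congr 1
    field_simp

open scoped ComplexOrder in
/-- A density operator that is not pure is the midpoint of two density operators that have different
expectation values in a given vector outside its kernel. -/
theorem exists_eq_midpoint_of_not_isPureState [FiniteDimensional ℂ V] {ρ : V →ₗ[ℂ] V}
    (hρ : IsDensityOperator ρ) (hpure : ¬ IsPureState ρ) {z : V} (hz : ρ z ≠ 0) :
    ∃ σ τ : V →ₗ[ℂ] V, IsDensityOperator σ ∧ IsDensityOperator τ ∧ ρ = (2⁻¹ : ℂ) • (σ + τ) ∧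
      (⟪z, σ z⟫_ℂ).re ≠ (⟪z, τ z⟫_ℂ).re := by
  obtain ⟨y, hy, hzy, hy0⟩ : ∃ y ∈ LinearMap.range ρ, ⟪z, y⟫_ℂ = 0 ∧ y ≠ 0 := by
    by_contra! h
    exact hpure (isPureState_of_forall_mem_range hρ hz h)
  have normalize : ∀ w ∈ LinearMap.range ρ, w ≠ 0 →
      (((‖w‖ : ℂ)⁻¹) • w) ∈ LinearMap.range ρ ∧ ‖((‖w‖ : ℂ)⁻¹) • w‖ = 1 := fun w hw h0 =>
    ⟨Submodule.smul_mem _ _ hw, by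
      rw [norm_smul, norm_inv, Complex.norm_real, norm_norm,
        inv_mul_cancel₀ (norm_ne_zero_iff.2 h0)]⟩
  obtain ⟨hu, hu1⟩ := normalize y hy hy0
  obtain ⟨hw, hw1⟩ := normalize (ρ z) (LinearMap.mem_range_self ρ z) hz
  have huz : ⟪((‖y‖ : ℂ)⁻¹) • y, z⟫_ℂ = 0 := by
    rw [inner_smul_left, inner_eq_zero_symm.1 hzy, mul_zero]
  have hwz : ⟪((‖ρ z‖ : ℂ)⁻¹) • ρ z, z⟫_ℂ ≠ 0 := by
    rw [inner_smul_left]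
    refine mul_ne_zero ?_ (inner_apply_self_ne_zero hρ.1 hz)
    simpa using hz
  generalize ((‖y‖ : ℂ)⁻¹) • y = u at hu hu1 huz
  generalize ((‖ρ z‖ : ℂ)⁻¹) • ρ z = w at hw hw1 hwz
  obtain ⟨s, hs, hsu⟩ := exists_isPositive_sub_smul_ketBra hρ.1 hu
  obtain ⟨r, hr, hrw⟩ := exists_isPositive_sub_smul_ketBra hρ.1 hw
  set c := min s r with hc
  have hc0 : 0 < c := lt_min hs hr
  have hcc : (0 : ℂ) ≤ (c : ℂ) := by exact_mod_cast hc0.le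
  have hdens : ∀ a b : V, ‖a‖ = 1 → ‖b‖ = 1 → (ρ - (c : ℂ) • ketBra b).IsPositive →
      IsDensityOperator (ρ - (c : ℂ) • ketBra b + (c : ℂ) • ketBra a) := fun a b ha hb hp =>
    ⟨hp.add ((isPositive_ketBra a).smul_of_nonneg hcc), by
      rw [map_add, map_sub, map_smul, map_smul, trace_ketBra ha, trace_ketBra hb, hρ.2]
      ring⟩
  -- Exchanging `u` and `w` gives the two endpoints. As `u ⊥ z`, their expectation values at `z`
  -- differ by `2 * c * ‖⟪w, z⟫‖ ^ 2`.
  refine ⟨_, _, hdens u w hu1 hw1 (hrw c hc0.le (min_le_right _ _)),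
    hdens w u hw1 hu1 (hsu c hc0.le (min_le_left _ _)), ?_, ?_⟩
  · module
  · have hpos : 0 < c * ‖⟪w, z⟫_ℂ‖ ^ 2 := by positivity
    have hexp : ∀ a b : V, (⟪z, (ρ - (c : ℂ) • ketBra b + (c : ℂ) • ketBra a) z⟫_ℂ).re =
        (⟪z, ρ z⟫_ℂ).re - c * ‖⟪b, z⟫_ℂ‖ ^ 2 + c * ‖⟪a, z⟫_ℂ‖ ^ 2 := fun a b => by
      simp only [LinearMap.add_apply, LinearMap.sub_apply, LinearMap.smul_apply, inner_add_right,
        inner_sub_right, inner_smul_right, Complex.add_re, Complex.sub_re, Complex.re_ofReal_mul]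
      rw [← isSymmetric_ketBra, ← isSymmetric_ketBra, re_inner_ketBra, re_inner_ketBra]
    rw [hexp, hexp, huz, norm_zero]
    intro h
    linarith

end DensityOperator

/-- No non-zero operator annihilates the orbit of a non-zero vector under an irreducible
representation. -/
theorem exists_apply_orbit_ne_zero {k G V : Type*} [Field k] [Group G] [AddCommGroup V]
    [Module k V] {π : Representation k G V} (hπ : π.IsIrreducible) {v : V} (hv : v ≠ 0)
    {T : V →ₗ[k] V} (hT : T ≠ 0) : ∃ g, T (π g v) ≠ 0 := by
  by_contra! h
  -- The vectors whose whole orbit is killed by `T` form an invariant subspace; it contains `v`,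
  -- hence is everything.
  let S : Subrepresentation π :=
    { toSubmodule := ⨅ g, LinearMap.ker (T ∘ₗ π g)
      apply_mem_toSubmodule := fun g x hx => by
        simp only [Submodule.mem_iInf, LinearMap.mem_ker, LinearMap.comp_apply] at hx ⊢
        intro g'
        rw [← Module.End.mul_apply (π g'), ← map_mul]
        exact hx _ }
  have hvS : v ∈ S.toSubmodule := by simpa [S] using h
  rcases hπ.eq_bot_or_eq_top S with hS | hS
  · rw [hS] at hvS
    exact hv hvS
  · refine hT (LinearMap.ext fun x => ?_)
    have hx : x ∈ S.toSubmodule := by rw [hS]; trivial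
    simp only [S, Submodule.mem_iInf, LinearMap.mem_ker, LinearMap.comp_apply] at hx
    simpa using hx 1

/-! ### Integrated strict concavity -/

section Integral

variable {X : Type*} [TopologicalSpace X] [CompactSpace X] [MeasurableSpace X]
  [OpensMeasurableSpace X] (μ : Measure X) [IsFiniteMeasure μ] [μ.IsOpenPosMeasure]

/-- Strict concavity, integrated over a compact space, for two different continuous functions. -/
theorem add_integral_lt_two_mul_integral_midpoint {φ : ℝ → ℝ}
    (hφ : StrictConcaveOn ℝ (Set.Ici 0) φ) (hφc : ContinuousOn φ (Set.Ici 0)) {f g : X → ℝ}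
    (hf : Continuous f) (hg : Continuous g) (hf0 : ∀ x, 0 ≤ f x) (hg0 : ∀ x, 0 ≤ g x) {x : X}
    (hx : f x ≠ g x) :
    (∫ x, φ (f x) ∂μ) + ∫ x, φ (g x) ∂μ < 2 * ∫ x, φ (2⁻¹ * (f x + g x)) ∂μ := by
  have hcont : ∀ u : X → ℝ, Continuous u → (∀ x, 0 ≤ u x) → Continuous fun x => φ (u x) :=
    fun u hu hu0 => hφc.comp_continuous hu hu0
  have hint : ∀ u : X → ℝ, Continuous u → Integrable u μ := fun u hu =>
    hu.integrable_of_hasCompactSupport (HasCompactSupport.of_compactSpace u)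
  have hm0 : ∀ x, 0 ≤ 2⁻¹ * (f x + g x) := fun x => by have := hf0 x; have := hg0 x; positivity
  have h1 := hcont f hf hf0
  have h2 := hcont g hg hg0
  have h3 := hcont (fun x => 2⁻¹ * (f x + g x)) (by fun_prop) hm0
  have h4 : Continuous fun x => 2 * φ (2⁻¹ * (f x + g x)) - (φ (f x) + φ (g x)) :=
    (h3.const_mul 2).sub (h1.add h2)
  have half : (0 : ℝ) < 2⁻¹ := by norm_num
  have halves : (2⁻¹ : ℝ) + 2⁻¹ = 1 := by norm_num
  have hlt : 0 < 2 * φ (2⁻¹ * (f x + g x)) - (φ (f x) + φ (g x)) := by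
    have := hφ.2 (hf0 x) (hg0 x) hx half half halves
    simp only [smul_eq_mul, ← mul_add] at this
    linarith
  have hnonneg : 0 ≤ fun x => 2 * φ (2⁻¹ * (f x + g x)) - (φ (f x) + φ (g x)) := fun x => by
    have := hφ.concaveOn.2 (hf0 x) (hg0 x) half.le half.le halves
    simp only [smul_eq_mul, ← mul_add] at this
    exact sub_nonneg.2 (by linarith)
  -- Strictness at the single point `x` spreads to a neighbourhood by continuity, and open sets have
  -- positive measure.
  have hpos := h4.integral_pos_of_hasCompactSupport_nonneg_nonzero (μ := μ)
    (HasCompactSupport.of_compactSpace _) hnonneg hlt.ne'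
  have hsum : Continuous fun x => φ (f x) + φ (g x) := h1.add h2
  rw [integral_sub (hint _ (h3.const_mul 2)) (hint _ hsum), integral_const_mul,
    integral_add (hint _ h1) (hint _ h2)] at hpos
  linarith

end Integral

/-! ### Strict quasi-concavity of the entropy -/

section Husimi

variable {G : Type*} [Group G] {V : Type*} [NormedAddCommGroup V] [InnerProductSpace ℂ V]
  {π : Representation ℂ G V} {v : V}

theorem husimi_nonneg {ρ : V →ₗ[ℂ] V} (hρ : ρ.IsPositive) (g : G) : 0 ≤ husimi π v ρ g :=
  hρ.re_inner_nonneg_right _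

theorem husimi_midpoint (σ τ : V →ₗ[ℂ] V) (g : G) :
    husimi π v ((2⁻¹ : ℂ) • (σ + τ)) g = 2⁻¹ * (husimi π v σ g + husimi π v τ g) := by
  have h : (2⁻¹ : ℂ) = ((2⁻¹ : ℝ) : ℂ) := by norm_num
  rw [husimi, LinearMap.smul_apply, LinearMap.add_apply, inner_smul_right, inner_add_right, h,
    Complex.re_ofReal_mul, Complex.add_re, husimi, husimi]

theorem continuous_husimi [FiniteDimensional ℂ V] [TopologicalSpace G]
    (hπ : Continuous fun g => π g v) (ρ : V →ₗ[ℂ] V) : Continuous (husimi π v ρ) :=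
  Complex.continuous_re.comp (hπ.inner (ρ.continuous_of_finiteDimensional.comp hπ))

theorem IsDensityOperator.ne_zero {ρ : V →ₗ[ℂ] V} (hρ : IsDensityOperator ρ) : ρ ≠ 0 := by
  rintro rfl
  simpa using hρ.2

theorem finrank_pos_of_ne_zero [FiniteDimensional ℂ V] (hv : v ≠ 0) :
    0 < (Module.finrank ℂ V : ℝ) := by
  have : Nontrivial V := ⟨v, 0, hv⟩
  exact_mod_cast Module.finrank_pos

variable [FiniteDimensional ℂ V] [TopologicalSpace G] [CompactSpace G] [MeasurableSpace G]
  [BorelSpace G] (μ : Measure G) [IsFiniteMeasure μ] [μ.IsOpenPosMeasure]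

/-- Needed to compare moments through their logarithms, since `Real.log` is strictly monotone only
on positive reals. -/
theorem moment_pos (hirr : π.IsIrreducible) (hπ : Continuous fun g => π g v) (hv : v ≠ 0) {q : ℝ}
    (hq : 0 < q) {ρ : V →ₗ[ℂ] V} (hρ : IsDensityOperator ρ) : 0 < moment μ π v q ρ := by
  obtain ⟨g, hg⟩ := exists_apply_orbit_ne_zero hirr hv hρ.ne_zero
  have hne : husimi π v ρ g ≠ 0 := fun h => by
    refine inner_apply_self_ne_zero hρ.1 hg ?_
    rw [hρ.1.isSymmetric]
    refine Complex.ext h ?_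
    simpa using (Complex.nonneg_iff.1 (hρ.1.inner_nonneg_right (π g v))).2.symm
  refine mul_pos (finrank_pos_of_ne_zero hv) ?_
  refine Continuous.integral_pos_of_hasCompactSupport_nonneg_nonzero (x := g)
    ((continuous_husimi hπ ρ).rpow_const fun _ => Or.inr hq.le)
    (HasCompactSupport.of_compactSpace _) (fun g => Real.rpow_nonneg (husimi_nonneg hρ.1 g) q) ?_
  exact (Real.rpow_pos_of_pos (lt_of_le_of_ne (husimi_nonneg hρ.1 g) hne.symm) q).ne'

/-- The Rényi–Wehrl entropy is strictly quasi-concave: at the midpoint of two density operators with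
different Husimi functions it exceeds one of the two entropies. -/
theorem renyiWehrlEntropy_lt_midpoint (hirr : π.IsIrreducible) (hπ : Continuous fun g => π g v)
    (hv : v ≠ 0) {q : ℝ} (hq : 0 < q) {σ τ : V →ₗ[ℂ] V} (hσ : IsDensityOperator σ)
    (hτ : IsDensityOperator τ) (hστ : IsDensityOperator ((2⁻¹ : ℂ) • (σ + τ))) {g : G}
    (hg : husimi π v σ g ≠ husimi π v τ g) :
    renyiWehrlEntropy μ π v q σ < renyiWehrlEntropy μ π v q ((2⁻¹ : ℂ) • (σ + τ)) ∨
      renyiWehrlEntropy μ π v q τ < renyiWehrlEntropy μ π v q ((2⁻¹ : ℂ) • (σ + τ)) := by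
  have hd : 0 < (Module.finrank ℂ V : ℝ) := finrank_pos_of_ne_zero hv
  have key : ∀ φ : ℝ → ℝ, StrictConcaveOn ℝ (Set.Ici 0) φ → ContinuousOn φ (Set.Ici 0) →
      (∫ g, φ (husimi π v σ g) ∂μ) + ∫ g, φ (husimi π v τ g) ∂μ <
        2 * ∫ g, φ (husimi π v ((2⁻¹ : ℂ) • (σ + τ)) g) ∂μ := fun φ hφ hφc => by
    simp only [husimi_midpoint]
    exact add_integral_lt_two_mul_integral_midpoint μ hφ hφc (continuous_husimi hπ σ)
      (continuous_husimi hπ τ) (husimi_nonneg hσ.1) (husimi_nonneg hτ.1) hg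
  have hMσ := moment_pos μ hirr hπ hv hq hσ
  have hMτ := moment_pos μ hirr hπ hv hq hτ
  have hM := moment_pos μ hirr hπ hv hq hστ
  generalize (2⁻¹ : ℂ) • (σ + τ) = ρ at *
  -- If neither endpoint has smaller entropy, undoing the logarithm and the prefactor bounds the sum
  -- of the endpoint integrals from the side that contradicts `key`.
  by_contra! hle
  rcases lt_trichotomy q 1 with h1 | rfl | h1
  · have hk := key (fun x => x ^ q) (Real.strictConcaveOn_rpow hq h1)
      (continuousOn_id.rpow_const fun _ _ => Or.inr hq.le)
    have hmono : ∀ a b : ℝ, 0 < b → 1 / (1 - q) * Real.log a ≤ 1 / (1 - q) * Real.log b →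
        0 < a → a ≤ b := fun a b hb h ha =>
      (Real.log_le_log_iff ha hb).1 (le_of_mul_le_mul_left h (one_div_pos.2 (sub_pos.2 h1)))
    simp only [renyiWehrlEntropy, if_neg h1.ne] at hle
    have e1 := hmono _ _ hMσ hle.1 hM
    have e2 := hmono _ _ hMτ hle.2 hM
    have e1 := le_of_mul_le_mul_left e1 hd
    have e2 := le_of_mul_le_mul_left e2 hd
    linarith
  · have hk := key Real.negMulLog Real.strictConcaveOn_negMulLog
      Real.continuous_negMulLog.continuousOn
    simp only [Real.negMulLog_eq_neg, integral_neg] at hk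
    simp only [renyiWehrlEntropy, if_pos, wehrlEntropy, neg_le_neg_iff] at hle
    have e1 := le_of_mul_le_mul_left hle.1 hd
    have e2 := le_of_mul_le_mul_left hle.2 hd
    linarith
  -- For `q > 1` the power is convex and `1 / (1 - q)` is negative, so the two sign changes cancel.
  · have hk := key (fun x => -x ^ q) (strictConvexOn_rpow h1).neg
      (continuousOn_id.rpow_const fun _ _ => Or.inr hq.le).neg
    simp only [integral_neg] at hk
    have hmono : ∀ a b : ℝ, 0 < a → 1 / (1 - q) * Real.log a ≤ 1 / (1 - q) * Real.log b →
        0 < b → b ≤ a := fun a b ha h hb =>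
      (Real.log_le_log_iff hb ha).1
        ((mul_le_mul_left_of_neg (one_div_neg.2 (sub_neg.2 h1))).1 h)
    simp only [renyiWehrlEntropy, if_neg h1.ne'] at hle
    have e1 := le_of_mul_le_mul_left (hmono _ _ hM hle.1 hMσ) hd
    have e2 := le_of_mul_le_mul_left (hmono _ _ hM hle.2 hMτ) hd
    linarith

end Husimi

end CoherentState

theorem lemma1
    {E : Type*} [NormedAddCommGroup E] [NormedSpace ℝ E] [FiniteDimensional ℝ E]
    {G : Type*} [TopologicalSpace G] [T2Space G] [ChartedSpace E G] [Group G]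
    [LieGroup 𝓘(ℝ, E) ∞ G] [CompactSpace G] [ConnectedSpace G]
    (hss : LieAlgebra.IsSemisimple ℝ (GroupLieAlgebra 𝓘(ℝ, E) G))
    [MeasurableSpace G] [BorelSpace G]
    (μ : Measure G) [μ.IsHaarMeasure] [IsProbabilityMeasure μ]
    (t : LieSubalgebra ℝ (GroupLieAlgebra 𝓘(ℝ, E) G)) (ht : t.IsCartanSubalgebra)
    (P : Set (t →ₗ[ℝ] ℂ)) (hP : CoherentState.IsPositiveSystem t P)
    {V : Type*} [NormedAddCommGroup V] [InnerProductSpace ℂ V] [FiniteDimensional ℂ V]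
    (π : Representation ℂ G V) (hπ : CoherentState.IsUnitaryIrrep (E := E) π)
    (lam : t →ₗ[ℝ] ℂ) (v : V) (hv : CoherentState.IsLowestWeightVector t P π lam v)
    (hv1 : ‖v‖ = 1)
    (q : ℝ) (hq : 0 < q)
    (ρ : V →ₗ[ℂ] V) (hρ : CoherentState.IsDensityOperator ρ)
    (hmin : ∀ σ : V →ₗ[ℂ] V, CoherentState.IsDensityOperator σ →
      CoherentState.renyiWehrlEntropy μ π v q ρ ≤ CoherentState.renyiWehrlEntropy μ π v q σ) :
    CoherentState.IsPureState ρ := by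
  by_contra hpure
  have hcont : Continuous fun g => π g v := (hπ.smooth v).continuous
  obtain ⟨g, hg⟩ := CoherentState.exists_apply_orbit_ne_zero hπ.irreducible hv.ne_zero hρ.ne_zero
  obtain ⟨σ, τ, hσ, hτ, rfl, hne⟩ :=
    CoherentState.exists_eq_midpoint_of_not_isPureState hρ hpure hg
  rcases CoherentState.renyiWehrlEntropy_lt_midpoint μ hπ.irreducible hcont hv.ne_zero hq hσ hτ hρ
    hne with h | h
  · exact absurd (hmin σ hσ) h.not_ge
  · exact absurd (hmin τ hτ) h.not_ge
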